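/- \textbf{Definitions.} A \emph{symmetric multicategory} $Q$ (with a category of objects) consists of: a category $\mathbb{C}$ (the object-category, whose morphisms are called object-morphisms); for all $k\ge 0$ and all objects $x_1,\dots,x_k,x$ of $\mathbb{C}$ a set $Q(x_1,\dots,x_k;x)$ of arrows; for each object-morphism $f:x\to y$ an arrow $\iota(f)\in Q(x;y)$, with $1_x:=\iota(1_x)$; composites $f\circ(g_1,\dots,g_k)\in Q(x_{11},\dots,x_{1m_1},\dots,x_{k1},\dots,x_{km_k};x)$ for $f\in Q(x_1,\dots,x_k;x)$ and $g_i\in Q(x_{i1},\dots,x_{im_i};x_i)$; and a right action $f\mapsto f\sigma$, $Q(x_1,\dots,x_k;x)\to Q(x_{\sigma(1)},\dots,x_{\sigma(k)};x)$, of permutations $\sigma\in S_k$. Composition is associative and unital, equivariant for permutations of the inputs of $f$ (acting by block permutations on the composite) and of the $g_i$ (acting by juxtaposition), and $\iota(f\circ g)=\iota(f)\circ\iota(g)$. $Q$ is \emph{freely symmetric} if $\alpha\sigma=\alpha$ implies $\sigma=\mathrm{id}$ for every arrow $\alpha$ and permutation $\sigma$. $Q$ is \emph{tidy} if it is freely symmetric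 and $\mathbb{C}$ is equivalent to a discrete category. The \emph{slice multicategory} $Q^+$ is the following symmetric multicategory. \begin{itemize} \item Its object-category is the category of elements $\mathrm{elt}(Q)$: objects are the arrows of $Q$. A morphism from $g\in Q(x_1,\dots,x_m;x)$ to $g'\in Q(y_1,\dots,y_m;y)$ consists of a permutation $\sigma\in S_m$ and object-morphisms $f_i:y_{\sigma(i)}\to x_i$ $(1\le i\le m)$ and $f:x\to y$ such that $g'\sigma=\iota(f)\circ g\circ(\iota(f_1),\dots,\iota(f_m))$. \item $Q^+(f_1,\dots,f_n;f)$ is the set of configurations for composing $f_1,\dots,f_n$ to yield $f$, i.e. of triples $(T,\rho,\tau)$, where: $T$ is a planar tree with $n$ nodes ($n=0$, a single edge, being allowed); $\tau$ is a bijection from the nodes of $T$ to $\{1,\dots,n\}$; the node $N$ is labelled by $f_{\tau(N)}$, and its incoming edges are in order-preserving bijection with the sources of $f_{\tau(N)}$; each edge is labelled by an object-morphism, with domain the target of the label of the node at its upper end, if there is one, and codomain the corresponding source of the label of the node at its lower end, if there is one, the upper ends of the leaf edges and the lower end of the root edge being typed by the sources (as reordered by $\rho$) and the target of $f$; $\rho$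 is a permutation of the leaves; and $f$ is obtained by composing the node labels $f_i$ and the arrows $\iota(a)$ of the edge labels $a$ in $Q$ as prescribed by $T$ and then letting $\rho$ act. \item Composition replaces nodes by (twisted) trees, composing the labels of edges that are joined, and moves all twists to the top. For an object-morphism $\alpha=(\sigma,f_1,\dots,f_m;f):g\to g'$, the arrow $\iota(\alpha)$ is the tree with one node labelled by $g$, with edge labels $f_1,\dots,f_m$ and $f$, and with the twist given by $\sigma$. The symmetric action is $(T,\rho,\tau)\sigma=(T,\rho,\sigma^{-1}\tau)$. \end{itemize} \textbf{Proposition.} Let $Q$ be a symmetric multicategory. If $Q$ is tidy, then its slice multicategory $Q^+$ is tidy. -/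

import Mathlib

open CategoryTheory

universe u v w

/-- Positions in a concatenation of `k` lists of lengths `m 0, …, m (k-1)`: the `s`-th entry of the
concatenation is the entry `(pos m s).2` of the list number `(pos m s).1` (lexicographic order). -/
abbrev pos {k : ℕ} (m : Fin k → ℕ) : Fin (∑ i, m i) ≃ (Σ i, Fin (m i)) :=
  finSigmaFinEquiv.symm

/-- Concatenation of a single list: the order preserving bijection. -/
def leftUnitBij (k : ℕ) : Fin (∑ _i : Fin 1, k) ≃ Fin k :=
  (pos fun _ : Fin 1 => k).trans
    ⟨fun s => s.2, fun j => ⟨0, j⟩, fun s => by rcases s with ⟨i, j⟩; simp [Subsingleton.elim i 0],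
      fun _ => rfl⟩

/-- Concatenation of `k` lists of length one: the order preserving bijection. -/
def rightUnitBij (k : ℕ) : Fin (∑ _i : Fin k, 1) ≃ Fin k :=
  (pos fun _ : Fin k => 1).trans
    ⟨fun s => s.1, fun i => ⟨i, 0⟩, fun s => by rcases s with ⟨i, j⟩; simp [Subsingleton.elim j 0],
      fun _ => rfl⟩

/-- The two ways of concatenating a list of lists of lists: the order preserving bijection. -/
def assocBij {k : ℕ} (m : Fin k → ℕ) (p : ∀ i, Fin (m i) → ℕ) :
    Fin (∑ i, ∑ j, p i j) ≃ Fin (∑ s, p (pos m s).1 (pos m s).2) :=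
  (pos fun i => ∑ j, p i j).trans <|
    (Equiv.sigmaCongrRight fun i => pos (p i)).trans <|
    (Equiv.sigmaAssoc fun i j => Fin (p i j)).symm.trans <|
    (Equiv.sigmaCongrLeft' (β := fun s : (Σ i, Fin (m i)) => Fin (p s.1 s.2)) (pos m).symm).trans <|
    (pos fun s => p (pos m s).1 (pos m s).2).symm

/-- `ρ(σ)`: the bijection that permutes blocks of lengths `m i` according to `σ`. -/
def blockBij {k k' : ℕ} (σ : Fin k' ≃ Fin k) (m : Fin k → ℕ) :
    Fin (∑ i, m (σ i)) ≃ Fin (∑ i, m i) :=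
  (pos fun i => m (σ i)).trans <|
    (Equiv.sigmaCongrLeft (β := fun i => Fin (m i)) σ).trans (pos m).symm

/-- The juxtaposition of the bijections `σ i`. -/
def juxtBij {k : ℕ} {m' m : Fin k → ℕ} (σ : ∀ i, Fin (m' i) ≃ Fin (m i)) :
    Fin (∑ i, m' i) ≃ Fin (∑ i, m i) :=
  (pos m').trans <| (Equiv.sigmaCongrRight σ).trans (pos m).symm

theorem pos_blockBij {k k' : ℕ} (σ : Fin k' ≃ Fin k) (m : Fin k → ℕ)
    (r : Fin (∑ i, m (σ i))) : pos m (blockBij σ m r) =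
      ⟨σ (pos (fun i => m (σ i)) r).1, (pos (fun i => m (σ i)) r).2⟩ := by
  simp [blockBij, Equiv.sigmaCongrLeft]

theorem pos_juxtBij {k : ℕ} {m' m : Fin k → ℕ} (σ : ∀ i, Fin (m' i) ≃ Fin (m i))
    (r : Fin (∑ i, m' i)) : pos m (juxtBij σ r) =
      ⟨(pos m' r).1, σ _ (pos m' r).2⟩ := by
  simp [juxtBij, Equiv.sigmaCongrRight]

/-- An entry of a concatenated list of lists, by its two kinds of address. -/
theorem pos_assocBij {α : Type*} {k : ℕ} (m : Fin k → ℕ) (p : ∀ i, Fin (m i) → ℕ)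
    (t : ∀ i j, Fin (p i j) → α) (r : Fin (∑ i, ∑ j, p i j)) :
    t (pos m (pos (fun s => p (pos m s).1 (pos m s).2) (assocBij m p r)).1).1
      (pos m (pos (fun s => p (pos m s).1 (pos m s).2) (assocBij m p r)).1).2
      (pos (fun s => p (pos m s).1 (pos m s).2) (assocBij m p r)).2 =
    t (pos (fun i => ∑ j, p i j) r).1
      (pos (p _) (pos (fun i => ∑ j, p i j) r).2).1
      (pos (p _) (pos (fun i => ∑ j, p i j) r).2).2 := by
  let E := Equiv.sigmaCongrLeft (β := fun q : (Σ i, Fin (m i)) => Fin (p q.1 q.2)) (pos m)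
  let q : (Σ q : (Σ i, Fin (m i)), Fin (p q.1 q.2)) :=
    ⟨⟨_, (pos (p _) (pos (fun i => ∑ j, p i j) r).2).1⟩,
      (pos (p _) (pos (fun i => ∑ j, p i j) r).2).2⟩
  have h : pos (fun s => p (pos m s).1 (pos m s).2) (assocBij m p r) = E.symm q :=
    Equiv.apply_symm_apply (pos fun s => p (pos m s).1 (pos m s).2) (E.symm q)
  rw [h]
  exact congrArg (fun q : (Σ q : (Σ i, Fin (m i)), Fin (p q.1 q.2)) => t q.1.1 q.1.2 q.2)
    (Equiv.apply_symm_apply E q)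

theorem assocBij_symm {k : ℕ} (m : Fin k → ℕ) (p : ∀ i, Fin (m i) → ℕ) (s : Fin (∑ i, m i))
    (l : Fin (p (pos m s).1 (pos m s).2)) :
    (assocBij m p).symm ((pos fun s => p (pos m s).1 (pos m s).2).symm ⟨s, l⟩) =
      (pos fun i => ∑ j, p i j).symm ⟨(pos m s).1, (pos (p _)).symm ⟨(pos m s).2, l⟩⟩ := by
  let E := Equiv.sigmaCongrLeft (β := fun q : (Σ i, Fin (m i)) => Fin (p q.1 q.2)) (pos m)
  have h : ∀ u, (assocBij m p).symm ((pos fun s => p (pos m s).1 (pos m s).2).symm u) =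
      (pos fun i => ∑ j, p i j).symm ⟨(E u).1.1, (pos (p _)).symm ⟨(E u).1.2, (E u).2⟩⟩ := by
    intro u
    refine congrArg (fun u => (pos fun i => ∑ j, p i j).symm
      ⟨(E u).1.1, (pos (p _)).symm ⟨(E u).1.2, (E u).2⟩⟩)
      (Equiv.apply_symm_apply (pos fun s => p (pos m s).1 (pos m s).2) u)
  exact h ⟨s, l⟩

/-- A symmetric multicategory with a category of objects.  `Hom x y` is the set
`Q(x_1, …, x_k; y)`.  The symmetric action is written for bijections `σ : Fin k' ≃ Fin k`; then
`k' = k`, and for `k'` literally equal to `k` this is the action of the permutations of `k` objects.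
Lengths such as `∑ i, m (σ i)` and `∑ i, m i` are equal but not syntactically so; the axioms
therefore contain the action of the evident order preserving bijections, and where the source lists
are equal but not syntactically equal, equality is written `HEq`. -/
structure SymMulticat where
  Obj : Type u
  [cat : Category.{v} Obj]
  Hom : {k : ℕ} → (Fin k → Obj) → Obj → Type w
  iota : {x y : Obj} → (x ⟶ y) → Hom (fun _ : Fin 1 => x) y
  comp : {k : ℕ} → {x : Fin k → Obj} → {y : Obj} → {m : Fin k → ℕ} →
    {z : ∀ i, Fin (m i) → Obj} → Hom x y → (∀ i, Hom (z i) (x i)) →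
    Hom (fun s => z (pos m s).1 (pos m s).2) y
  act : {k k' : ℕ} → (σ : Fin k' ≃ Fin k) → {x : Fin k → Obj} → {y : Obj} → Hom x y →
    Hom (fun i => x (σ i)) y
  id_comp : ∀ {k : ℕ} {x : Fin k → Obj} {y : Obj} (f : Hom x y),
    comp (iota (𝟙 y)) (fun _ => f) = act (leftUnitBij k) f
  comp_id : ∀ {k : ℕ} {x : Fin k → Obj} {y : Obj} (f : Hom x y),
    comp f (fun i => iota (𝟙 (x i))) = act (rightUnitBij k) f
  assoc : ∀ {k : ℕ} {x : Fin k → Obj} {y : Obj} {m : Fin k → ℕ} {z : ∀ i, Fin (m i) → Obj}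
    {p : ∀ i, Fin (m i) → ℕ} {t : ∀ i j, Fin (p i j) → Obj}
    (f : Hom x y) (g : ∀ i, Hom (z i) (x i)) (h : ∀ i j, Hom (t i j) (z i j)),
    HEq (comp f fun i => comp (g i) (h i))
      (act (assocBij m p) (comp (comp f g) fun s => h (pos m s).1 (pos m s).2))
  act_refl : ∀ {k : ℕ} {x : Fin k → Obj} {y : Obj} (f : Hom x y), act (Equiv.refl _) f = f
  act_act : ∀ {k k' k'' : ℕ} (σ : Fin k' ≃ Fin k) (σ' : Fin k'' ≃ Fin k') {x : Fin k → Obj}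
    {y : Obj} (f : Hom x y), act σ' (act σ f) = act (σ'.trans σ) f
  act_comp : ∀ {k k' : ℕ} (σ : Fin k' ≃ Fin k) {x : Fin k → Obj} {y : Obj} {m : Fin k → ℕ}
    {z : ∀ i, Fin (m i) → Obj} (f : Hom x y) (g : ∀ i, Hom (z i) (x i)),
    HEq (comp (act σ f) fun i => g (σ i)) (act (blockBij σ m) (comp f g))
  comp_act : ∀ {k : ℕ} {x : Fin k → Obj} {y : Obj} {m m' : Fin k → ℕ}
    (σ : ∀ i, Fin (m' i) ≃ Fin (m i)) {z : ∀ i, Fin (m i) → Obj}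
    (f : Hom x y) (g : ∀ i, Hom (z i) (x i)),
    HEq (comp f fun i => act (σ i) (g i)) (act (juxtBij σ) (comp f g))
  iota_comp : ∀ {x y z : Obj} (a : x ⟶ y) (b : y ⟶ z),
    comp (iota b) (fun _ => iota a) = act (leftUnitBij 1) (iota (a ≫ b))

attribute [instance] SymMulticat.cat

namespace SymMulticat

/-- `α σ = α` implies `σ = 1`; the equality of arrows includes the equality of their sources. -/
def FreelySymmetric (Q : SymMulticat.{u, v, w}) : Prop :=
  ∀ (k : ℕ) (x : Fin k → Q.Obj) (y : Q.Obj) (f : Q.Hom x y) (σ : Equiv.Perm (Fin k)),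
    (fun i => x (σ i)) = x → HEq (Q.act σ f) f → σ = 1

/-- Freely symmetric, with object-category equivalent to a discrete one. -/
def Tidy (Q : SymMulticat.{u, v, w}) : Prop :=
  Q.FreelySymmetric ∧ ∃ S : Type u, Nonempty (Q.Obj ≌ Discrete S)

variable {Q : SymMulticat.{u, v, w}}

/-- An arrow of `Q` with inputs labelled by `lab` in `L`, where a label `l` stands for the
object `X l`. -/
@[ext]
structure LArr (Q : SymMulticat.{u, v, w}) {L : Type} (X : L → Q.Obj) (y : Q.Obj) where
  arity : ℕ
  lab : Fin arity → L
  arr : Q.Hom (fun i => X (lab i)) y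

namespace LArr

/-- An arrow of arity `k`, its inputs labelled by their positions. -/
def of {k : ℕ} {x : Fin k → Q.Obj} {y : Q.Obj} (f : Q.Hom x y) : LArr Q x y := ⟨k, id, f⟩

/-- The unary arrow `ι(a)`, its input labelled by `l`. -/
def single {L : Type} {X : L → Q.Obj} {y : Q.Obj} (l : L) (a : X l ⟶ y) : LArr Q X y :=
  ⟨1, fun _ => l, Q.iota a⟩

/-- The composite `f ∘ (s_1, …, s_k)`, labels being kept. -/
def bind {L : Type} {X : L → Q.Obj} {k : ℕ} {x : Fin k → Q.Obj} {y : Q.Obj} (f : Q.Hom x y)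
    (s : ∀ i, LArr Q X (x i)) : LArr Q X y :=
  ⟨∑ i, (s i).arity, fun r => (s (pos _ r).1).lab (pos (fun i => (s i).arity) r).2,
    Q.comp f fun i => (s i).arr⟩

/-- The symmetric action; labels are permuted along with the inputs. -/
def perm {L : Type} {X : L → Q.Obj} {y : Q.Obj} (A : LArr Q X y) {k : ℕ}
    (σ : Fin k ≃ Fin A.arity) : LArr Q X y :=
  ⟨k, fun i => A.lab (σ i), Q.act σ A.arr⟩

/-- `B` is obtained from `A` by the symmetric action. -/
def Same {L : Type} {X : L → Q.Obj} {y : Q.Obj} (A B : LArr Q X y) : Prop :=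
  ∃ (k : ℕ) (σ : Fin k ≃ Fin A.arity), B = A.perm σ

theorem mk_congr {L : Type} {X : L → Q.Obj} {y : Q.Obj} {k : ℕ} {l l' : Fin k → L}
    {f : Q.Hom (fun i => X (l i)) y} {f' : Q.Hom (fun i => X (l' i)) y} (h : l = l')
    (hf : HEq f f') : (⟨k, l, f⟩ : LArr Q X y) = ⟨k, l', f'⟩ := by
  subst h; rw [eq_of_heq hf]

variable {L : Type} {X : L → Q.Obj} {y : Q.Obj}

theorem Same.refl (A : LArr Q X y) : A.Same A :=
  ⟨_, Equiv.refl _, by simp [perm, Q.act_refl]⟩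

theorem perm_perm (A : LArr Q X y) {k k' : ℕ} (σ : Fin k ≃ Fin A.arity) (τ : Fin k' ≃ Fin k) :
    (A.perm σ).perm (k := k') τ = A.perm (τ.trans σ) := by
  simp only [perm, Q.act_act]; rfl

theorem Same.trans {A B C : LArr Q X y} (h : A.Same B) (h' : B.Same C) : A.Same C := by
  obtain ⟨k, σ, rfl⟩ := h
  obtain ⟨k', τ, rfl⟩ := h'
  exact ⟨k', Equiv.trans τ σ, perm_perm A σ τ⟩

theorem Same.symm {A B : LArr Q X y} (h : A.Same B) : B.Same A := by
  obtain ⟨k, σ, rfl⟩ := h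
  refine ⟨A.arity, σ.symm, ?_⟩
  rw [perm_perm A σ σ.symm, Equiv.symm_trans_self]
  simp [perm, Q.act_refl]

theorem Same.of_eq {A B : LArr Q X y} (h : A = B) : A.Same B := h ▸ Same.refl A

theorem bind_perm {k : ℕ} {x : Fin k → Q.Obj} (f : Q.Hom x y) (s : ∀ i, LArr Q X (x i))
    {m' : Fin k → ℕ} (σ : ∀ i, Fin (m' i) ≃ Fin (s i).arity) :
    bind f (fun i => (s i).perm (σ i)) = (bind f s).perm (juxtBij σ) := by
  refine mk_congr ?_ (Q.comp_act σ f fun i => (s i).arr)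
  funext r
  exact congrArg (fun p : (Σ i, Fin (s i).arity) => (s p.1).lab p.2) (pos_juxtBij σ r).symm

theorem bind_congr {k : ℕ} {x : Fin k → Q.Obj} (f : Q.Hom x y) {s s' : ∀ i, LArr Q X (x i)}
    (h : ∀ i, (s i).Same (s' i)) : (bind f s).Same (bind f s') := by
  choose m' σ h using h
  obtain rfl : s' = fun i => (s i).perm (σ i) := funext h
  exact ⟨_, juxtBij σ, bind_perm f s σ⟩

theorem bind_act {k k' : ℕ} (σ : Fin k' ≃ Fin k) {x : Fin k → Q.Obj} (f : Q.Hom x y)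
    (s : ∀ i, LArr Q X (x i)) :
    bind (Q.act σ f) (fun i => s (σ i)) = (bind f s).perm (blockBij σ fun i => (s i).arity) := by
  refine mk_congr ?_ (Q.act_comp σ f fun i => (s i).arr)
  funext r
  exact congrArg (fun p : (Σ i, Fin (s i).arity) => (s p.1).lab p.2) (pos_blockBij σ _ r).symm

theorem bind_congr_left {M : Type} {Y : M → Q.Obj} {A B : LArr Q Y y} (h : A.Same B)
    (s : ∀ l, LArr Q X (Y l)) :
    (bind A.arr fun i => s (A.lab i)).Same (bind B.arr fun i => s (B.lab i)) := by
  obtain ⟨k, σ, rfl⟩ := h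
  exact ⟨_, _, bind_act σ A.arr fun i => s (A.lab i)⟩

theorem bind_bind {k : ℕ} {x : Fin k → Q.Obj} (f : Q.Hom x y) {M : Type} {Y : M → Q.Obj}
    (A : ∀ i, LArr Q Y (x i)) (s : ∀ l, LArr Q X (Y l)) :
    (bind (bind f A).arr fun r => s ((bind f A).lab r)).Same
      (bind f fun i => bind (A i).arr fun j => s ((A i).lab j)) := by
  refine ⟨_, assocBij (fun i => (A i).arity) fun i j => (s ((A i).lab j)).arity, ?_⟩
  refine mk_congr ?_ (Q.assoc f (fun i => (A i).arr) fun i j => (s ((A i).lab j)).arr)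
  funext r
  exact (pos_assocBij (fun i => (A i).arity) (fun i j => (s ((A i).lab j)).arity)
    (fun i j => (s ((A i).lab j)).lab) r).symm

theorem id_bind (A : LArr Q X y) : A.Same (bind (Q.iota (𝟙 y)) fun _ => A) :=
  ⟨_, leftUnitBij A.arity, mk_congr rfl (heq_of_eq (Q.id_comp A.arr))⟩

theorem bind_single {k : ℕ} {x : Fin k → Q.Obj} (f : Q.Hom x y) :
    (of f).Same (bind f fun i => single i (𝟙 (x i))) :=
  ⟨_, rightUnitBij k, mk_congr rfl (heq_of_eq (Q.comp_id f))⟩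

theorem iota_bind {x z : Q.Obj} (a : x ⟶ y) (b : y ⟶ z) (A : LArr Q X x) :
    (bind (Q.iota (a ≫ b)) fun _ => A).Same
      (bind (Q.iota b) fun _ => bind (Q.iota a) fun _ => A) := by
  have h : (single (X := fun _ : Unit => x) () (a ≫ b)).Same
      (bind (Q.iota b) fun _ => single () a) :=
    ⟨_, leftUnitBij 1, mk_congr rfl (heq_of_eq (Q.iota_comp a b))⟩
  exact (bind_congr_left h fun _ => A).trans
    (bind_bind (Q.iota b) (fun _ => single (X := fun _ : Unit => x) () a) fun _ => A)

theorem iota_single {l : L} {z : Q.Obj} (a : X l ⟶ y) (b : y ⟶ z) :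
    (single l (a ≫ b)).Same (bind (Q.iota b) fun _ => single l a) :=
  ⟨_, leftUnitBij 1, mk_congr rfl (heq_of_eq (Q.iota_comp a b))⟩

end LArr


/-- Objects of `elt(Q)`, the category of elements of `Q`: arrows of `Q`. -/
structure Elt (Q : SymMulticat.{u, v, w}) where
  {arity : ℕ}
  {src : Fin arity → Q.Obj}
  {tgt : Q.Obj}
  arr : Q.Hom src tgt

/-- Planar trees whose nodes are labelled by arrows of `Q`, whose edges are labelled by
object-morphisms and whose leaves carry numbers in `L`, the leaf `l` being an input of type `X l`;
`Tree F X y` consists of the trees whose root edge is labelled by a morphism into `y`.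
Every node also carries a number `i` in `N`, and its label has to be `F i`.

`leaf l a` is the tree without nodes whose only edge is labelled by `a`. In `node g i h sub a` the
root edge, labelled by `a`, comes out of a node labelled by `g` whose `j`-th input is the root edge
of `sub j`. -/
inductive Tree {N : Type} (F : N → Q.Elt) {L : Type} (X : L → Q.Obj) :
    Q.Obj → Type (max u v w)
  | leaf (l : L) {y : Q.Obj} (a : X l ⟶ y) : Tree F X y
  | node (g : Q.Elt) (i : N) (h : F i = g) (sub : ∀ j : Fin g.arity, Tree F X (g.src j))
      {y : Q.Obj} (a : g.tgt ⟶ y) : Tree F X y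

namespace Tree

variable {N N' N'' L L' L'' : Type} {F : N → Q.Elt} {F' : N' → Q.Elt} {F'' : N'' → Q.Elt}
  {X : L → Q.Obj} {X' : L' → Q.Obj} {X'' : L'' → Q.Obj} {y z : Q.Obj}

/-- The result of composing the node labels as arrows of `Q` according to their positions in the
tree, an edge label `a` acting as `ι(a)`. The inputs are labelled by the leaf numbers. -/
def eval {y : Q.Obj} : Tree F X y → LArr Q X y
  | leaf l a => LArr.single l a
  | node g _ _ sub a => LArr.bind (Q.iota a) fun _ => LArr.bind g.arr fun j => (sub j).eval

/-- The number of nodes that carry the number `n`. -/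
def nodeCount [DecidableEq N] (n : N) {y : Q.Obj} : Tree F X y → ℕ
  | leaf _ _ => 0
  | node _ i _ sub _ => (if i = n then 1 else 0) + ∑ j, (sub j).nodeCount n

/-- Renumbering of the nodes. -/
def renumber (φ : N → N') (hφ : ∀ i, F' (φ i) = F i) {y : Q.Obj} : Tree F X y → Tree F' X y
  | leaf l a => leaf l a
  | node g i h sub a => node g (φ i) ((hφ i).trans h) (fun j => (sub j).renumber φ hφ) a

/-- Composing the label of the root edge with `a`. -/
def post (a : y ⟶ z) : Tree F X y → Tree F X z
  | leaf l b => leaf l (b ≫ a)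
  | node g i h sub b => node g i h sub (b ≫ a)

/-- Joining the root edge of `s l` to every leaf with number `l`. The labels of the two edges that
become one are composed. -/
def graft (s : ∀ l, Tree F X' (X l)) {y : Q.Obj} : Tree F X y → Tree F X' y
  | leaf l a => (s l).post a
  | node g i h sub a => node g i h (fun j => (sub j).graft s) a

/-- Replacing every node by a tree: the leaf number `j` of the tree `B i g h` is joined to the
(replaced) subtree above the `j`-th input of the node. -/
def subst (B : ∀ i g, F i = g → Tree F' g.src g.tgt) {y : Q.Obj} : Tree F X y → Tree F' X y
  | leaf l a => leaf l a
  | node g i h sub a => ((B i g h).graft fun j => (sub j).subst B).post a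

/-- The tree with one node, labelled by `g`. -/
def corolla (g : Q.Elt) (i : N) (h : F i = g) (π : Fin g.arity → L)
    (b : ∀ j, X (π j) ⟶ g.src j) (a : g.tgt ⟶ y) : Tree F X y :=
  node g i h (fun j => leaf (π j) (b j)) a

theorem post_post {x : Q.Obj} (t : Tree F X x) (a : x ⟶ y) (b : y ⟶ z) :
    (t.post a).post b = t.post (a ≫ b) := by
  cases t <;> simp [post]

theorem post_id (t : Tree F X y) : t.post (𝟙 y) = t := by
  cases t <;> simp [post]

theorem graft_post (s : ∀ l, Tree F X' (X l)) (t : Tree F X y) (a : y ⟶ z) :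
    (t.post a).graft s = (t.graft s).post a := by
  cases t with
  | leaf l b => exact (post_post (s l) b a).symm
  | node g i h sub b => rfl

theorem graft_graft (s : ∀ l, Tree F X' (X l)) (s' : ∀ l, Tree F X'' (X' l)) (t : Tree F X y) :
    (t.graft s).graft s' = t.graft fun l => (s l).graft s' := by
  induction t with
  | leaf l a => simp [graft, graft_post]
  | node g i h sub a ih => simp [graft, ih]

theorem graft_leaf (t : Tree F X y) : t.graft (fun l => leaf l (𝟙 (X l))) = t := by
  induction t with
  | leaf l a => simp [graft, post]
  | node g i h sub a ih => simp [graft, ih]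

theorem subst_post (B : ∀ i g, F i = g → Tree F' g.src g.tgt) (t : Tree F X y) (a : y ⟶ z) :
    (t.post a).subst B = (t.subst B).post a := by
  cases t with
  | leaf l b => rfl
  | node g i h sub b => exact (post_post _ b a).symm

theorem subst_graft (B : ∀ i g, F i = g → Tree F' g.src g.tgt) (s : ∀ l, Tree F X' (X l))
    (t : Tree F X y) : (t.graft s).subst B = (t.subst B).graft fun l => (s l).subst B := by
  induction t with
  | leaf l a => simp [graft, subst, subst_post]
  | node g i h sub a ih => simp [graft, subst, ih, graft_post, graft_graft]

theorem subst_subst (B : ∀ i g, F i = g → Tree F' g.src g.tgt)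
    (B' : ∀ i g, F' i = g → Tree F'' g.src g.tgt) (t : Tree F X y) :
    (t.subst B).subst B' = t.subst fun i g h => (B i g h).subst B' := by
  induction t with
  | leaf l a => simp [subst]
  | node g i h sub a ih => simp [subst, ih, subst_post, subst_graft]

theorem renumber_post (φ : N → N') (hφ : ∀ i, F' (φ i) = F i) (t : Tree F X y) (a : y ⟶ z) :
    (t.post a).renumber φ hφ = (t.renumber φ hφ).post a := by
  cases t <;> simp [post, renumber]

theorem renumber_graft (φ : N → N') (hφ : ∀ i, F' (φ i) = F i) (s : ∀ l, Tree F X' (X l))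
    (t : Tree F X y) :
    (t.graft s).renumber φ hφ = (t.renumber φ hφ).graft fun l => (s l).renumber φ hφ := by
  induction t with
  | leaf l a => simp [graft, renumber, renumber_post]
  | node g i h sub a ih => simp [graft, renumber, ih]

theorem renumber_subst (φ : N' → N'') (hφ : ∀ i, F'' (φ i) = F' i)
    (B : ∀ i g, F i = g → Tree F' g.src g.tgt) (t : Tree F X y) :
    (t.subst B).renumber φ hφ = t.subst fun i g h => (B i g h).renumber φ hφ := by
  induction t with
  | leaf l a => simp [subst, renumber]
  | node g i h sub a ih => simp [subst, ih, renumber_post, renumber_graft]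

theorem subst_renumber (φ : N → N') (hφ : ∀ i, F' (φ i) = F i)
    (B : ∀ i g, F' i = g → Tree F'' g.src g.tgt) (t : Tree F X y) :
    (t.renumber φ hφ).subst B = t.subst fun i g h => B (φ i) g ((hφ i).trans h) := by
  induction t with
  | leaf l a => simp [subst, renumber]
  | node g i h sub a ih => simp [subst, renumber, ih]

theorem renumber_renumber (φ : N → N') (hφ : ∀ i, F' (φ i) = F i) (ψ : N' → N'')
    (hψ : ∀ i, F'' (ψ i) = F' i) (t : Tree F X y) :
    (t.renumber φ hφ).renumber ψ hψ =
      t.renumber (fun i => ψ (φ i)) (fun i => (hψ (φ i)).trans (hφ i)) := by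
  induction t with
  | leaf l a => simp [renumber]
  | node g i h sub a ih => simp [renumber, ih]

theorem renumber_congr {φ ψ : N → N'} (h : ∀ i, φ i = ψ i) (hφ : ∀ i, F' (φ i) = F i)
    (hψ : ∀ i, F' (ψ i) = F i) (t : Tree F X y) : t.renumber φ hφ = t.renumber ψ hψ := by
  obtain rfl : φ = ψ := funext h
  rfl

theorem renumber_id (t : Tree F X y) (φ : N → N) (hφ : ∀ i, F (φ i) = F i) (h : ∀ i, φ i = i) :
    t.renumber φ hφ = t := by
  induction t with
  | leaf l a => simp [renumber]
  | node g i h' sub a ih => simp [renumber, ih, h]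

/-- Replacing each node by the corolla with the same label renumbers the nodes. -/
theorem subst_corolla (φ : N → N') (hφ : ∀ i, F' (φ i) = F i) (t : Tree F X y) :
    (t.subst fun i g h => corolla g (φ i) ((hφ i).trans h) id (fun j => 𝟙 (g.src j)) (𝟙 g.tgt)) =
      t.renumber φ hφ := by
  induction t with
  | leaf l a => simp [renumber, subst]
  | node g i h sub a ih =>
    have e : ∀ j, ((leaf j (𝟙 (g.src j)) : Tree F' g.src (g.src j)).graft fun j =>
        (sub j).renumber φ hφ) = (sub j).renumber φ hφ := fun j => post_id _
    simp only [renumber, subst, ih]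
    simp only [corolla, graft, post, Category.id_comp, id]
    exact congrArg (fun f => node g (φ i) ((hφ i).trans h) f a) (funext e)

theorem eval_renumber (φ : N → N') (hφ : ∀ i, F' (φ i) = F i) (t : Tree F X y) :
    (t.renumber φ hφ).eval = t.eval := by
  induction t with
  | leaf l a => simp [renumber, eval]
  | node g i h sub a ih => simp [renumber, eval, ih]

theorem eval_post (t : Tree F X y) (a : y ⟶ z) :
    (t.post a).eval.Same (LArr.bind (Q.iota a) fun _ => t.eval) := by
  cases t with
  | leaf l b => exact LArr.iota_single b a
  | node g i h sub b => exact LArr.iota_bind b a _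

theorem eval_graft (s : ∀ l, Tree F X' (X l)) (t : Tree F X y) :
    (t.graft s).eval.Same (LArr.bind t.eval.arr fun p => (s (t.eval.lab p)).eval) := by
  induction t with
  | leaf l a => exact eval_post (s l) a
  | node g i h sub a ih =>
    refine .trans (LArr.bind_congr _ fun _ => LArr.bind_congr g.arr ih) ?_
    refine .trans (LArr.bind_congr _ fun _ =>
      (LArr.bind_bind g.arr (fun j => (sub j).eval) fun l => (s l).eval).symm) ?_
    exact (LArr.bind_bind (Q.iota a) (fun _ => LArr.bind g.arr fun j => (sub j).eval)
      fun l => (s l).eval).symm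

theorem eval_subst (B : ∀ i g, F i = g → Tree F' g.src g.tgt)
    (hB : ∀ i g h, (LArr.of g.arr).Same (B i g h).eval) (t : Tree F X y) :
    (t.subst B).eval.Same t.eval := by
  induction t with
  | leaf l a => exact .refl _
  | node g i h sub a ih =>
    refine .trans (eval_post _ a) (LArr.bind_congr _ fun _ => ?_)
    refine .trans (eval_graft _ _) ?_
    refine .trans (LArr.bind_congr_left (hB i g h).symm fun j => ((sub j).subst B).eval) ?_
    exact LArr.bind_congr g.arr ih

theorem nodeCount_renumber [DecidableEq N] [DecidableEq N'] (φ : N → N')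
    (hφ : ∀ i, F' (φ i) = F i) (inj : Function.Injective φ) (n : N) (t : Tree F X y) :
    (t.renumber φ hφ).nodeCount (φ n) = t.nodeCount n := by
  induction t with
  | leaf l a => simp [renumber, nodeCount]
  | node g i h sub a ih => simp [renumber, nodeCount, ih, inj.eq_iff]

theorem nodeCount_renumber_of_ne [DecidableEq N'] (φ : N → N')
    (hφ : ∀ i, F' (φ i) = F i) (n : N') (hn : ∀ i, φ i ≠ n) (t : Tree F X y) :
    (t.renumber φ hφ).nodeCount n = 0 := by
  induction t with
  | leaf l a => simp [renumber, nodeCount]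
  | node g i h sub a ih => simp [renumber, nodeCount, ih, hn]

theorem nodeCount_post [DecidableEq N] (n : N) (t : Tree F X y) (a : y ⟶ z) :
    (t.post a).nodeCount n = t.nodeCount n := by
  cases t <;> simp [post, nodeCount]

theorem nodeCount_graft [DecidableEq N] (n : N) (s : ∀ l, Tree F X' (X l)) (t : Tree F X y) :
    (t.graft s).nodeCount n = t.nodeCount n + ∑ p, (s (t.eval.lab p)).nodeCount n := by
  induction t with
  | leaf l a =>
    rw [graft, nodeCount_post, nodeCount, zero_add]
    exact (Fin.sum_univ_one fun _ : Fin 1 => (s l).nodeCount n).symm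
  | node g i h sub a ih =>
    have key : ∀ {k : ℕ} {x : Fin k → Q.Obj} {y : Q.Obj} (f : Q.Hom x y) (A : ∀ i, LArr Q X (x i)),
        (∑ p, (s ((LArr.bind f A).lab p)).nodeCount n : ℕ) =
          ∑ i, ∑ p, (s ((A i).lab p)).nodeCount n := by
      intro k x y f A
      rw [← Fintype.sum_sigma' fun i p => (s ((A i).lab p)).nodeCount n]
      exact Equiv.sum_comp (pos fun i => (A i).arity)
        (fun q : (Σ i, Fin (A i).arity) => (s ((A q.1).lab q.2)).nodeCount n)
    have e : (∑ p, (s ((node g i h sub a).eval.lab p)).nodeCount n : ℕ) =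
        ∑ j, ∑ p, (s ((sub j).eval.lab p)).nodeCount n :=
      (key (Q.iota a) fun _ => LArr.bind g.arr fun j => (sub j).eval).trans
        ((Fin.sum_univ_one _).trans (key g.arr fun j => (sub j).eval))
    rw [e]
    simp only [graft, nodeCount, ih]
    rw [Finset.sum_add_distrib, add_assoc]

/-- If the leaves of each `B i g h` are numbered bijectively, each node of `t` contributes the nodes
of exactly one copy of the tree that replaces it. -/
theorem nodeCount_subst [DecidableEq N] [DecidableEq N']
    (B : ∀ i g, F i = g → Tree F' g.src g.tgt)
    (hB : ∀ i g h, (LArr.of g.arr).Same (B i g h).eval) (n : N) (n' : N')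
    (h0 : ∀ i g h, (B i g h).nodeCount n' = if i = n then 1 else 0) (t : Tree F X y) :
    (t.subst B).nodeCount n' = t.nodeCount n := by
  induction t with
  | leaf l a => simp [subst, nodeCount]
  | node g i h sub a ih =>
    rw [subst, nodeCount_post, nodeCount_graft, nodeCount, h0]
    obtain ⟨k, σ, e⟩ := hB i g h
    rw [e]
    congr 1
    exact (Equiv.sum_comp σ fun j => ((sub j).subst B).nodeCount n').trans
      (Finset.sum_congr rfl fun j _ => ih j)

theorem same_corolla (g : Q.Elt) (i : N) (h : F i = g) :
    (LArr.of g.arr).Same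
      (corolla g i h id (fun j => 𝟙 (g.src j)) (𝟙 g.tgt) : Tree F g.src g.tgt).eval :=
  (LArr.bind_single g.arr).trans (LArr.id_bind _)

end Tree

/-- Morphisms of `elt(Q)`: an arrow `(σ, f_1, …, f_k; f)` of `(ℱ C)ᵒᵖ × C` that takes `p` to `q`,
i.e. the composite `ι(f) ∘ p ∘ (ι(f_1), …, ι(f_k))` is `q` up to the permutation `σ` of the
inputs. In that composite the `i`-th input is labelled `σ i`, so that the condition says that the
input labelled `j` corresponds to the `j`-th input of `q`. -/
@[ext]
structure Elt.Hom (p q : Q.Elt) where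
  perm : Fin p.arity ≃ Fin q.arity
  src : ∀ i, q.src (perm i) ⟶ p.src i
  tgt : p.tgt ⟶ q.tgt
  map_eq : (LArr.of q.arr).Same
    (LArr.bind (Q.iota tgt) fun _ => LArr.bind p.arr fun i => LArr.single (perm i) (src i))

/-- The one node tree of a morphism of elements, with its edge labels and its twist. -/
def Elt.Hom.toTree {p q : Q.Elt} (α : p.Hom q) {N : Type} {F : N → Q.Elt} (i : N) (h : F i = p) :
    Tree F q.src q.tgt :=
  Tree.corolla p i h α.perm α.src α.tgt

theorem Elt.Hom.toTree_comp {p q r : Q.Elt} (α : p.Hom q) (β : q.Hom r) {N : Type}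
    {F : N → Q.Elt} (i : N) (h : F i = p) :
    ((β.toTree () rfl : Tree (fun _ : Unit => q) r.src r.tgt).subst fun _ _ e =>
      e ▸ α.toTree i h) =
    Tree.corolla p i h (fun j => β.perm (α.perm j)) (fun j => β.src (α.perm j) ≫ α.src j)
      (α.tgt ≫ β.tgt) := by
  simp [Elt.Hom.toTree, Tree.corolla, Tree.subst, Tree.graft, Tree.post]

instance : Category.{v} Q.Elt where
  Hom p q := p.Hom q
  id p := ⟨Equiv.refl _, fun i => 𝟙 _, 𝟙 _, Tree.same_corolla (F := fun _ : Unit => p) p () rfl⟩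
  comp {p q r} α β := ⟨α.perm.trans β.perm, fun i => β.src (α.perm i) ≫ α.src i, α.tgt ≫ β.tgt, by
    have h := Tree.eval_subst (F' := fun _ : Unit => p) (fun _ g e => e ▸ α.toTree () rfl)
      (fun _ g e => by subst e; exact α.map_eq)
      (β.toTree () rfl : Tree (fun _ : Unit => q) r.src r.tgt)
    rw [Elt.Hom.toTree_comp] at h
    exact β.map_eq.trans h.symm⟩
  id_comp α := by ext <;> simp
  comp_id α := by ext <;> simp
  assoc α β γ := by ext <;> simp

/-- The set `Q⁺(F_1, …, F_n; f)` of configurations `(T, ρ, τ)` for composing the `F_i` to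
yield `f`: a planar tree with `n` nodes, numbered bijectively (by `τ`) such that the node number `i`
is labelled by `F i`, and whose leaves are numbered bijectively (by the twist) such that
the composite according to the tree is `f` up to the permutation given by the leaf numbers. -/
structure Config {n : ℕ} (F : Fin n → Q.Elt) (f : Q.Elt) where
  tree : Tree F f.src f.tgt
  once : ∀ i, tree.nodeCount i = 1
  yields : (LArr.of f.arr).Same tree.eval

namespace Config

theorem ext_tree {n : ℕ} {F : Fin n → Q.Elt} {f : Q.Elt} {c c' : Config F f}
    (h : c.tree = c'.tree) : c = c' := by
  cases c; cases c'; cases h; rfl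

theorem heq_of_tree {n : ℕ} {F F' : Fin n → Q.Elt} {f : Q.Elt} (hF : F' = F) {c : Config F f}
    {c' : Config F' f} (h : c.tree.renumber id (fun i => congrFun hF i) = c'.tree) :
    HEq c c' := by
  subst hF
  exact heq_of_eq (ext_tree ((Tree.renumber_id _ _ _ fun _ => rfl).symm.trans h))

/-- The configuration with one node given by a morphism of elements. -/
def iota {p q : Q.Elt} (α : p ⟶ q) : Config (fun _ : Fin 1 => p) q where
  tree := Elt.Hom.toTree α 0 rfl
  once i := by
    simp [Elt.Hom.toTree, Tree.corolla, Tree.nodeCount, Subsingleton.elim i 0]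
  yields := Elt.Hom.map_eq α

/-- The symmetric action renumbers the nodes by `σ⁻¹`. -/
def act {n n' : ℕ} (σ : Fin n' ≃ Fin n) {F : Fin n → Q.Elt} {f : Q.Elt} (c : Config F f) :
    Config (fun i => F (σ i)) f where
  tree := c.tree.renumber σ.symm fun i => congrArg F (σ.apply_symm_apply i)
  once i := by
    have h := Tree.nodeCount_renumber (F' := fun i => F (σ i)) σ.symm
      (fun i => congrArg F (σ.apply_symm_apply i)) σ.symm.injective (σ i) c.tree
    rw [σ.symm_apply_apply] at h
    rw [h, c.once]
  yields := by rw [Tree.eval_renumber]; exact c.yields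

/-- The trees that replace the nodes in a composite, their nodes renumbered by position in the
concatenated list. -/
def inner {k : ℕ} {F : Fin k → Q.Elt} {m : Fin k → ℕ} {G : ∀ i, Fin (m i) → Q.Elt}
    (d : ∀ i, Config (G i) (F i)) (i : Fin k) (g : Q.Elt) (h : F i = g) :
    Tree (fun s => G (pos m s).1 (pos m s).2) g.src g.tgt :=
  h ▸ (d i).tree.renumber (fun j => (pos m).symm ⟨i, j⟩) fun j =>
    congrArg (fun q : (Σ i, Fin (m i)) => G q.1 q.2) ((pos m).apply_symm_apply ⟨i, j⟩)

/-- The node number `i` of `c` is replaced by the tree `d i`. -/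
def comp {k : ℕ} {F : Fin k → Q.Elt} {f : Q.Elt} {m : Fin k → ℕ} {G : ∀ i, Fin (m i) → Q.Elt}
    (c : Config F f) (d : ∀ i, Config (G i) (F i)) :
    Config (fun s => G (pos m s).1 (pos m s).2) f where
  tree := c.tree.subst (inner d)
  once r := by
    obtain ⟨⟨i, j⟩, rfl⟩ := (pos m).symm.surjective r
    refine (Tree.nodeCount_subst (inner d) ?_ i _ ?_ c.tree).trans (c.once i)
    · intro i g h
      subst h
      simp only [inner, Tree.eval_renumber]
      exact (d i).yields
    · intro i' g h
      subst h
      simp only [inner]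
      split_ifs with hi
      · subst hi
        exact (Tree.nodeCount_renumber (fun j => (pos m).symm ⟨i', j⟩) _
          (fun a b e => by simpa using e) j _).trans
          ((d i').once j)
      · exact Tree.nodeCount_renumber_of_ne _ _ _ (fun a e => hi (by
          have := (pos m).symm.injective e
          exact congrArg Sigma.fst this)) _
  yields := c.yields.trans (Tree.eval_subst (inner d) (by
    intro i g h
    subst h
    simp only [inner, Tree.eval_renumber]
    exact (d i).yields) c.tree).symm

theorem inner_assoc {k : ℕ} {m : Fin k → ℕ} {G : ∀ i, Fin (m i) → Q.Elt}
    {p : ∀ i, Fin (m i) → ℕ} {T : ∀ i j, Fin (p i j) → Q.Elt}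
    (e : ∀ i j, Config (T i j) (G i j)) (i : Fin k) (j : Fin (m i)) (h1 h2 h3) :
    (e i j).tree.renumber
      (F' := fun r => T (pos m (pos (fun s => p (pos m s).1 (pos m s).2) (assocBij m p r)).1).1
        (pos m (pos (fun s => p (pos m s).1 (pos m s).2) (assocBij m p r)).1).2
        (pos (fun s => p (pos m s).1 (pos m s).2) (assocBij m p r)).2)
      (fun l => id ((pos fun i => ∑ j, p i j).symm ⟨i, (pos (p i)).symm ⟨j, l⟩⟩)) h1 =
    (inner (F := fun s => G (pos m s).1 (pos m s).2)
      (G := fun s => T (pos m s).1 (pos m s).2) (fun s => e (pos m s).1 (pos m s).2)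
      ((pos m).symm ⟨i, j⟩) (G i j) h2).renumber (assocBij m p).symm h3 := by
  have hs : pos m ((pos m).symm ⟨i, j⟩) = ⟨i, j⟩ := (pos m).apply_symm_apply _
  generalize (pos m).symm ⟨i, j⟩ = s at *
  obtain ⟨rfl, hj⟩ := Sigma.mk.inj_iff.mp hs
  obtain rfl := eq_of_heq hj
  refine .trans ?_ (Tree.renumber_renumber _ _ _ _ _).symm
  refine Tree.renumber_congr (fun l => ?_) _ _ _
  exact (assocBij_symm m p s l).symm

end Config

/-- The slice multicategory `Q⁺`. -/
def slice (Q : SymMulticat.{u, v, w}) : SymMulticat.{max u w, v, max u v w} where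
  Obj := Q.Elt
  Hom F f := Config F f
  iota α := Config.iota α
  comp c d := c.comp d
  act σ _ _ c := c.act σ
  id_comp c := Config.ext_tree (by
    refine (Tree.post_id _).trans ?_
    refine (Tree.graft_leaf _).trans (Tree.renumber_congr (fun _ => rfl) _ _ _))
  comp_id {k F f} c := Config.ext_tree (by
    refine .trans ?_ (Tree.subst_corolla (rightUnitBij k).symm
      (fun i => congrArg F ((rightUnitBij k).apply_symm_apply i)) c.tree)
    refine congrArg (c.tree.subst ·) ?_
    funext i g h
    subst h
    rfl)
  assoc {k F f m G p T} c d e := by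
    refine Config.heq_of_tree (funext fun r => pos_assocBij m p T r) ?_
    refine (Tree.renumber_subst _ _ _ _).trans (.trans ?_ ((congrArg (Tree.renumber _ _)
      (Tree.subst_subst _ _ _)).trans (Tree.renumber_subst _ _ _ _)).symm)
    refine congrArg (c.tree.subst ·) ?_
    funext i g h
    subst h
    refine (congrArg (Tree.renumber _ _) (Tree.renumber_subst _ _ _ _)).trans
      ((Tree.renumber_subst _ _ _ _).trans (.trans ?_ ((congrArg (Tree.renumber _ _)
        (Tree.subst_renumber _ _ _ _)).trans (Tree.renumber_subst _ _ _ _)).symm))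
    refine congrArg ((d i).tree.subst ·) ?_
    funext j g h
    subst h
    exact (congrArg (Tree.renumber _ _) (Tree.renumber_renumber _ _ _ _ _)).trans
      ((Tree.renumber_renumber _ _ _ _ _).trans (Config.inner_assoc e i j _ _ _))
  act_refl c := Config.ext_tree (Tree.renumber_id _ _ _ fun _ => rfl)
  act_act σ σ' _ _ c := Config.ext_tree (Tree.renumber_renumber _ _ _ _ _)
  act_comp {k k'} σ {F f m G} c d := by
    refine Config.heq_of_tree (funext fun r => congrArg
      (fun q : (Σ i, Fin (m i)) => G q.1 q.2) (pos_blockBij σ m r)) ?_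
    refine ((congrArg (Tree.renumber _ _) (Tree.subst_renumber _ _ _ _)).trans
      (Tree.renumber_subst _ _ _ _)).trans (.trans ?_ (Tree.renumber_subst _ _ _ _).symm)
    refine congrArg (c.tree.subst ·) ?_
    funext i g h
    subst h
    obtain ⟨i, rfl⟩ := σ.surjective i
    have key : ∀ i' (e : i' = i) (h : F (σ i') = F (σ i)),
        Config.inner (F := fun i => F (σ i)) (fun i => d (σ i)) i' (F (σ i)) h =
          Config.inner (F := fun i => F (σ i)) (fun i => d (σ i)) i (F (σ i)) rfl := by
      intro i' e h
      subst e
      rfl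
    refine (congrArg (Tree.renumber _ _) (key _ (σ.symm_apply_apply i) _)).trans ?_
    refine (Tree.renumber_renumber _ _ _ _ _).trans
      (.trans ?_ (Tree.renumber_renumber _ _ _ _ _).symm)
    refine Tree.renumber_congr ?_ _ _ _
    intro j
    refine (Equiv.symm_apply_eq _).mpr ?_ |>.symm
    refine (Equiv.symm_apply_eq (pos m)).mpr ?_
    refine .trans ?_ (pos_blockBij σ m _).symm
    exact congrArg (fun q : (Σ i, Fin (m (σ i))) => (⟨σ q.1, q.2⟩ : Σ i, Fin (m i)))
      ((pos fun i => m (σ i)).apply_symm_apply ⟨i, j⟩).symm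
  comp_act {k F f m m'} σ {G} c d := by
    refine Config.heq_of_tree (funext fun r => congrArg
      (fun q : (Σ i, Fin (m i)) => G q.1 q.2) (pos_juxtBij σ r)) ?_
    refine (Tree.renumber_subst _ _ _ _).trans (.trans ?_ (Tree.renumber_subst _ _ _ _).symm)
    refine congrArg (c.tree.subst ·) ?_
    funext i g h
    subst h
    refine ((Tree.renumber_renumber _ _ _ _ _).trans (Tree.renumber_renumber _ _ _ _ _)).trans
      (.trans ?_ (Tree.renumber_renumber _ _ _ _ _).symm)
    refine Tree.renumber_congr ?_ _ _ _
    intro j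
    refine (Equiv.eq_symm_apply _).mpr ?_
    refine (Equiv.eq_symm_apply (pos m)).mpr ?_
    refine (pos_juxtBij σ _).trans ?_
    refine (congrArg (fun q : (Σ i, Fin (m' i)) => (⟨q.1, σ q.1 q.2⟩ : Σ i, Fin (m i)))
      ((pos m').apply_symm_apply ⟨i, (σ i).symm j⟩)).trans ?_
    exact congrArg (Sigma.mk i) ((σ i).apply_symm_apply j)
  iota_comp α β := Config.ext_tree (by
    simp [Config.iota, Config.comp, Config.act, Config.inner, Elt.Hom.toTree, Tree.corolla,
      Tree.subst, Tree.graft, Tree.post, Tree.renumber]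
    exact ⟨Subsingleton.elim (α := Fin 1) _ _, rfl, rfl⟩)

end SymMulticat

namespace SymMulticat

/-! Tidiness of the slice splits into two independent claims.

Free symmetry of `Q⁺` holds for every `Q`: a permutation acts by renumbering the nodes of a tree,
which leaves its shape and labels alone. If the tree is unchanged, every node keeps its number, and
every number occurs on some node (`slice_freelySymmetric`).

For the object-category, being equivalent to a discrete category means that parallel morphisms agree
and every morphism can be reversed. Reversal in `elt(Q)` is componentwise: invert the permutation
and reverse all object-morphisms; the required identity holds because composites such as `f ≫ g` are
identities by thinness (`Elt.nonempty_hom_symm`).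

Thinness of `elt(Q)` (`Elt.isThin`) is where free symmetry of `Q` enters. Two morphisms `p ⟶ q` can
differ only in their permutations `σ` and `τ`, since object-morphisms are unique. Inputs `σ i` and
`τ i` of `q` have isomorphic but possibly unequal types, whereas free symmetry concerns equal source
lists. So the inputs of `q` are first precomposed with morphisms from chosen representatives of
their isomorphism classes. The two composites built from `p` then become the same arrow, and each is
a permutation of the modified `q`; by freeness these two permutations agree. Comparing input labels
gives `σ = τ`. -/

/-- A category is equivalent to a discrete one iff it is a preorder in which `≤` is symmetric. -/
theorem nonempty_equivalence_discrete_iff {C : Type u} [Category.{v} C] :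
    (∃ S : Type u, Nonempty (C ≌ Discrete S)) ↔
      Quiver.IsThin C ∧ ∀ x y : C, (x ⟶ y) → Nonempty (y ⟶ x) := by
  constructor
  · rintro ⟨S, ⟨e⟩⟩
    refine ⟨fun x y => ⟨fun a b => e.functor.map_injective (Subsingleton.elim _ _)⟩,
      fun x y a => ⟨e.functor.preimage ?_⟩⟩
    exact eqToHom (Discrete.ext (Discrete.eq_of_hom (e.functor.map a)).symm)
  · rintro ⟨thin, symm⟩
    -- Any reverse morphism is an inverse, since both composites are endomorphisms in a thin
    -- category.
    let iso {x y : C} (a : x ⟶ y) : x ≅ y :=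
      ⟨a, (symm x y a).some, (thin _ _).elim _ _, (thin _ _).elim _ _⟩
    let G : C ⥤ Discrete (Quotient (isIsomorphicSetoid C)) :=
      { obj x := ⟨Quotient.mk _ x⟩
        map a := eqToHom (congrArg Discrete.mk (Quotient.sound ⟨iso a⟩)) }
    have : G.Full := ⟨fun {x y} b =>
      ⟨(Quotient.exact (Discrete.eq_of_hom b)).some.hom, Subsingleton.elim _ _⟩⟩
    have : G.Faithful := ⟨fun {x y} a b _ => (thin x y).elim a b⟩
    have : G.EssSurj := ⟨fun ⟨s⟩ => by
      obtain ⟨x, rfl⟩ := Quotient.exists_rep s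
      exact ⟨x, ⟨Iso.refl _⟩⟩⟩
    have : G.IsEquivalence := {}
    exact ⟨_, ⟨G.asEquivalence⟩⟩

variable {Q : SymMulticat.{u, v, w}}

/-! ### Labelled arrows: freeness of the action and composites with unary arrows -/

namespace LArr

variable {L L' : Type} {X : L → Q.Obj} {X' : L' → Q.Obj} {y : Q.Obj}

/-- Relabelling of the inputs. -/
def relabel (φ : L → L') (A : LArr Q (fun l => X' (φ l)) y) : LArr Q X' y :=
  ⟨A.arity, fun i => φ (A.lab i), A.arr⟩

theorem Same.exists_perm {A B : LArr Q X y} (h : A.Same B) :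
    ∃ σ : Fin B.arity ≃ Fin A.arity, B = A.perm σ := by
  obtain ⟨k, σ, rfl⟩ := h
  exact ⟨σ, rfl⟩

/-- Equality of labels gives, through `X`, the equality of source lists that free symmetry demands.
-/
theorem eq_one_of_perm_eq (hQ : Q.FreelySymmetric) {A : LArr Q X y}
    {σ : Equiv.Perm (Fin A.arity)} (h : A.perm σ = A) : σ = 1 := by
  obtain ⟨k, lab, arr⟩ := A
  obtain ⟨-, hl, ha⟩ := LArr.ext_iff.mp h
  exact hQ _ _ _ arr σ (congrArg (fun l i => X (l i)) (eq_of_heq hl)) ha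

/-- A free action has injective orbit maps: `σ⁻¹τ` stabilises `A.perm σ`, hence is trivial. -/
theorem perm_injective (hQ : Q.FreelySymmetric) (A : LArr Q X y) {k : ℕ}
    {σ τ : Fin k ≃ Fin A.arity} (h : A.perm σ = A.perm τ) : σ = τ := by
  have e : (τ.trans σ.symm).trans σ = τ := by
    rw [Equiv.trans_assoc, Equiv.symm_trans_self, Equiv.trans_refl]
  have h1 := eq_one_of_perm_eq hQ (A := A.perm σ) (σ := τ.trans σ.symm)
    ((perm_perm A σ (τ.trans σ.symm)).trans ((congrArg A.perm e).trans h.symm))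
  ext i
  exact congrArg Fin.val
    ((Equiv.symm_apply_eq σ).mp (congrArg (fun e : Equiv.Perm (Fin k) => e i) h1)).symm

theorem single_congr [Quiver.IsThin Q.Obj] {l l' : L} (h : l = l') (a : X l ⟶ y) (b : X l' ⟶ y) :
    single l a = single l' b := by
  subst h
  rw [Subsingleton.elim a b]

/-- Substitution into `ι(f) ∘ p ∘ (ι(a_1), …, ι(a_k))`. -/
theorem bind_iota_bind_single {x : Q.Obj} {k : ℕ} {w : Fin k → Q.Obj} (p : Q.Hom w x)
    (f : x ⟶ y) (π : Fin k → L) (a : ∀ i, X (π i) ⟶ w i) (φ : L → L')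
    (b : ∀ l, X' (φ l) ⟶ X l) :
    (bind (bind (Q.iota f) fun _ => bind p fun i => single (π i) (a i)).arr fun r =>
      single (X := X') (φ ((bind (Q.iota f) fun _ => bind p fun i =>
        single (X := X) (π i) (a i)).lab r)) (b _)).Same
      (bind (Q.iota f) fun _ => bind p fun i => single (φ (π i)) (b (π i) ≫ a i)) := by
  refine (bind_bind (Q.iota f) (fun _ => bind p fun i => single (X := X) (π i) (a i))
    fun l => single (X := X') (φ l) (b l)).trans (bind_congr _ fun _ => ?_)
  refine (bind_bind p (fun i => single (X := X) (π i) (a i))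
    fun l => single (X := X') (φ l) (b l)).trans (bind_congr _ fun i => ?_)
  exact (iota_single (b (π i)) (a i)).symm

/-- The labels of `ι(f) ∘ p ∘ (ι(a_1), …, ι(a_k))`. -/
theorem label_eq_of_bind_single_eq {x : Q.Obj} {k : ℕ} {w : Fin k → Q.Obj} {p : Q.Hom w x}
    {f : x ⟶ y} {π π' : Fin k → L} {a : ∀ i, X (π i) ⟶ w i} {a' : ∀ i, X (π' i) ⟶ w i}
    (h : (bind (Q.iota f) fun _ => bind p fun i => single (π i) (a i)) =
      bind (Q.iota f) fun _ => bind p fun i => single (π' i) (a' i)) : π = π' := by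
  obtain ⟨-, hl, -⟩ := LArr.ext_iff.mp h
  have hl := eq_of_heq hl
  funext i
  -- `r` is the position of the `i`-th input of `p` in the nested concatenation: the only outer
  -- block, inner block `i`, its only entry. The label there is `π i` on one side and `π' i` on the
  -- other.
  let u : Fin (∑ _i : Fin k, 1) := (pos fun _ => 1).symm ⟨i, 0⟩
  let r : Fin (∑ _i : Fin 1, ∑ _i : Fin k, 1) := (pos fun _ => _).symm ⟨0, u⟩
  have hr : (pos (fun _ : Fin k => 1) (pos (fun _ : Fin 1 => ∑ _i : Fin k, 1) r).2).1 = i := by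
    simp [r, u]
  have h1 : π (pos (fun _ : Fin k => 1) (pos (fun _ : Fin 1 => ∑ _i : Fin k, 1) r).2).1 =
    π' (pos (fun _ : Fin k => 1) (pos (fun _ : Fin 1 => ∑ _i : Fin k, 1) r).2).1 := congrFun hl r
  rwa [hr] at h1

end LArr

/-! ### The category of elements: thinness and reversal of morphisms -/

namespace Elt

/-- The permutation of a morphism of elements is determined by free symmetry, after the inputs have
been replaced by representatives of their isomorphism classes. -/
theorem isThin (hQ : Q.FreelySymmetric) [Quiver.IsThin Q.Obj]
    (symm : ∀ x y : Q.Obj, (x ⟶ y) → Nonempty (y ⟶ x)) : Quiver.IsThin Q.Elt := by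
  intro p q
  refine ⟨fun (α β : p.Hom q) => ?_⟩
  obtain ⟨σ, a, f, hα⟩ := α
  obtain ⟨τ, b, f', hβ⟩ := β
  obtain rfl := Subsingleton.elim f f'
  -- Inputs of `q` are identified when their types are isomorphic; `c` picks a representative input
  -- and `e` maps its type to the original one.
  let S : Setoid (Fin q.arity) :=
    ⟨fun i j => Nonempty (q.src i ⟶ q.src j), fun _ => ⟨𝟙 _⟩, fun ⟨u⟩ => symm _ _ u,
      fun ⟨u⟩ ⟨v⟩ => ⟨u ≫ v⟩⟩
  let c (j : Fin q.arity) : Fin q.arity := (Quotient.mk S j).out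
  let e (j : Fin q.arity) : q.src (c j) ⟶ q.src j := (Quotient.mk_out (s := S) j).some
  -- The types of the inputs `σ i` and `τ i` both map to `p.src i`, so they are isomorphic.
  have hc (i) : c (σ i) = c (τ i) :=
    congrArg Quotient.out (Quotient.sound (s := S) ⟨a i ≫ (symm _ _ (b i)).some⟩)
  let X' (j : Fin q.arity) : Q.Obj := q.src (c j)
  -- `B` has the types of the representatives as sources but still carries the original labels `j`,
  -- from which `σ` and `τ` can be recovered.
  let B : LArr Q X' q.tgt := .bind q.arr fun j => .single j (e j)
  have key (π : Fin p.arity → Fin q.arity) (a : ∀ i, q.src (π i) ⟶ p.src i)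
      (h : (LArr.of q.arr).Same
        (.bind (Q.iota f) fun _ => .bind p.arr fun i => .single (π i) (a i))) :
      B.Same (.bind (Q.iota f) fun _ => .bind p.arr fun i => .single (π i) (e (π i) ≫ a i)) :=
    (LArr.bind_congr_left h fun j => LArr.single (X := X') j (e j)).trans
      (LArr.bind_iota_bind_single (X' := X') p.arr f π a id e)
  obtain ⟨s, hs⟩ := (key σ a hα).exists_perm
  obtain ⟨t, ht⟩ := (key τ b hβ).exists_perm
  -- Once labels are collapsed along `c`, the two composites coincide: labels by `hc`, unary arrows
  -- by thinness.
  have hE : (LArr.bind (Q.iota f) fun _ => LArr.bind p.arr fun i =>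
        LArr.single (X := q.src) (c (σ i)) (e (σ i) ≫ a i)) =
      LArr.bind (Q.iota f) fun _ => LArr.bind p.arr fun i =>
        LArr.single (X := q.src) (c (τ i)) (e (τ i) ≫ b i) :=
    congrArg (fun g => LArr.bind (Q.iota f) fun _ => LArr.bind p.arr g)
      (funext fun i => LArr.single_congr (hc i) _ _)
  have hst : s = t := LArr.perm_injective hQ (LArr.relabel (X' := q.src) c B)
    ((congrArg (LArr.relabel c) hs).symm.trans (hE.trans (congrArg (LArr.relabel c) ht)))
  subst hst
  -- With `s = t`, the composites agree even with their uncollapsed labels, which are `σ i` and `τ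
  -- i`.
  obtain rfl : σ = τ :=
    DFunLike.coe_injective (LArr.label_eq_of_bind_single_eq (hs.trans ht.symm))
  obtain rfl : a = b := funext fun i => Subsingleton.elim _ _
  rfl

theorem nonempty_hom_symm [Quiver.IsThin Q.Obj]
    (symm : ∀ x y : Q.Obj, (x ⟶ y) → Nonempty (y ⟶ x)) (p q : Q.Elt) (α : p ⟶ q) :
    Nonempty (q ⟶ p) := by
  obtain ⟨σ, a, f, h⟩ : p.Hom q := α
  obtain ⟨g⟩ := symm _ _ f
  have hb (j) : Nonempty (p.src (σ.symm j) ⟶ q.src j) := by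
    obtain ⟨i, rfl⟩ := σ.surjective j
    rw [σ.symm_apply_apply]
    exact symm _ _ (a i)
  let b j := (hb j).some
  refine ⟨(⟨σ.symm, b, g, ?_⟩ : q.Hom p)⟩
  -- Precomposing the condition on `α` with the `b j` compares `q ∘ (ι(b_j))` with `ι(f) ∘ p ∘
  -- (ι(b_{σ i} ≫ a_i))`; by thinness the innermost arrows are identities.
  have h1 := (LArr.bind_congr_left h fun j => LArr.single (σ.symm j) (b j)).trans
    (LArr.bind_iota_bind_single p.arr f σ a σ.symm b)
  have h2 : (fun i => LArr.single (X := p.src) (σ.symm (σ i)) (b (σ i) ≫ a i)) =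
      fun i => LArr.single i (𝟙 (p.src i)) :=
    funext fun i => LArr.single_congr (σ.symm_apply_apply i) _ _
  rw [h2] at h1
  refine .trans (LArr.id_bind _) ?_
  -- Splitting the identity as `f ≫ g` leaves `ι(g)` outside and turns the inner part `ι(f) ∘ p`
  -- into `q ∘ (ι(b_j))` by `h1`.
  rw [Subsingleton.elim (𝟙 p.tgt) (f ≫ g)]
  refine (LArr.iota_bind f g _).trans (LArr.bind_congr _ fun _ => .trans ?_ h1.symm)
  exact LArr.bind_congr _ fun _ => LArr.bind_single p.arr

end Elt

/-! ### Free symmetry of the slice -/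

/-- Renumbering preserves positions, so comparing the trees node by node shows that `φ` fixes every
number that occurs. The families `F'` and `F` are kept apart because permuting the inputs of a
configuration gives a family that is only propositionally equal to the original. -/
theorem Tree.eq_of_renumber_eq {N L : Type} [DecidableEq N] {F F' : N → Q.Elt} {X : L → Q.Obj}
    {y : Q.Obj} (hF : F' = F) {φ : N → N} (hφ : ∀ i, F' (φ i) = F i) (t : Tree F X y)
    (h : t.renumber φ hφ ≍ t) (n : N) (hn : t.nodeCount n ≠ 0) : φ n = n := by
  subst hF
  replace h := eq_of_heq h
  induction t with
  | leaf l a => exact absurd rfl hn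
  | node g i _ sub a ih =>
    simp only [renumber, node.injEq, heq_eq_eq, true_and, and_true] at h
    by_cases hi : i = n
    · exact hi ▸ h.1
    · simp only [nodeCount, if_neg hi, zero_add] at hn
      obtain ⟨j, -, hj⟩ := Finset.exists_ne_zero_of_sum_ne_zero hn
      exact ih j hj (congrFun h.2 j)

/-- A permutation of the node numbers that fixes a configuration is trivial, since every number
occurs in the tree. -/
theorem slice_freelySymmetric (Q : SymMulticat.{u, v, w}) : Q.slice.FreelySymmetric := by
  intro k (F : Fin k → Q.Elt) f (c : Config F f) σ hF (h : c.act σ ≍ c)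
  have hF : (fun i => F (σ i)) = F := hF
  -- Stated for a variable `G`, since the equation for `fun i => F (σ i)` cannot be substituted away
  -- directly.
  have tree_heq {G : Fin k → Q.Elt} (hG : G = F) {d : Config G f} (hd : d ≍ c) :
      d.tree ≍ c.tree := by
    subst hG
    rw [eq_of_heq hd]
  ext i
  have hi := Tree.eq_of_renumber_eq hF (fun i => congrArg F (σ.apply_symm_apply i)) c.tree
    (tree_heq hF h) i (by rw [c.once]; exact one_ne_zero)
  exact congrArg Fin.val ((Equiv.symm_apply_eq σ).mp hi).symm

end SymMulticat

theorem mainTheorem5 (Q : SymMulticat.{u, v, w}) (hQ : Q.Tidy) : Q.slice.Tidy := by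
  obtain ⟨free, discrete⟩ := hQ
  obtain ⟨thin, symm⟩ := SymMulticat.nonempty_equivalence_discrete_iff.mp discrete
  exact ⟨Q.slice_freelySymmetric, SymMulticat.nonempty_equivalence_discrete_iff.mpr
    ⟨SymMulticat.Elt.isThin free symm, SymMulticat.Elt.nonempty_hom_symm symm⟩⟩
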